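/- Let $q=2^m$ and $\sigma=2^k$ with $1\le k<m$, let $d=\gcd(k,m)$, and let $a,b,c\in\mathbb F_q$ with $a\neq 0$. Define $F=(F_1,F_2,F_3)\colon\mathbb F_q^3\to\mathbb F_q^3$ by \begin{align*} F_1(x,y,z)&=x^{\sigma+1}+ay^{\sigma}z+bx^{\sigma}y+cx^{\sigma}z,\\ F_2(x,y,z)&=ay^{\sigma+1}+z^{\sigma}x+bz^{\sigma}y+cx^{\sigma}y,\\ F_3(x,y,z)&=z^{\sigma+1}+x^{\sigma}y. \end{align*} This map is $\sigma$-semiquadratic, i.e. for each $i$ there is a matrix $C^{(i)}\in M_3(\mathbb F_q)$ with $F_i(x,y,z)=(x,y,z)\,C^{(i)}\,(x^\sigma,y^\sigma,z^\sigma)^T$. If the equation $$a x^{\sigma^2+\sigma+1}+b x^{\sigma+1}+c x+1=0$$ has no solution $x\in\mathbb F_q$, then the differential uniformity of $F$, $$\Delta_F=\max\{\#\{w\in\mathbb F_q^3 : F(w+u)-F(w)=v\} : u,v\in\mathbb F_q^3,\ u\neq 0\},$$ equals $2^d$. In particular, if $d=1$, then $F$ is almost perfect nonlinear (APN), i.e.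 $\Delta_F=2$. -/

import Mathlib

/-- Entry `(u, v)` of the difference distribution table of `F`:
the number of `x` such that `F (x + u) - F x = v`. -/
noncomputable def ddt {G : Type*} [AddCommGroup G] (F : G → G) (u v : G) : ℕ :=
  {x : G | F (x + u) - F x = v}.ncard

/-- The differential uniformity of `F`: the largest entry `ddt F u v` with `u ≠ 0`.
On a finite nontrivial group it is an honest maximum, see
`isGreatest_differentialUniformity`. -/
noncomputable def differentialUniformity {G : Type*} [AddCommGroup G] (F : G → G) : ℕ :=
  sSup {n : ℕ | ∃ u v : G, u ≠ 0 ∧ ddt F u v = n}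

theorem isGreatest_differentialUniformity {G : Type*} [AddCommGroup G] [Finite G]
    [Nontrivial G] (F : G → G) :
    IsGreatest {n : ℕ | ∃ u v : G, u ≠ 0 ∧ ddt F u v = n} (differentialUniformity F) := by
  have hne : {n : ℕ | ∃ u v : G, u ≠ 0 ∧ ddt F u v = n}.Nonempty := by
    obtain ⟨u, hu⟩ := exists_ne (0 : G)
    exact ⟨_, u, 0, hu, rfl⟩
  have hb : BddAbove {n : ℕ | ∃ u v : G, u ≠ 0 ∧ ddt F u v = n} := by
    refine ⟨Nat.card G, ?_⟩
    rintro n ⟨u, v, -, rfl⟩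
    exact Set.ncard_le_card _
  exact ⟨Nat.sSup_mem hne hb, fun n hn => le_csSup hb hn⟩

/-- Almost perfect nonlinear functions. The notion is meant for functions on a finite vector
space over the field with two elements, where `2` is the least possible value. -/
def IsAPN {G : Type*} [AddCommGroup G] (F : G → G) : Prop :=
  differentialUniformity F = 2

/-- `H` is a `σ`-semiquadratic map on `K ^ ℓ`: every component has the form
`(y₁, …, y_ℓ) C (y₁ ^ σ, …, y_ℓ ^ σ)ᵀ` for a matrix `C` over `K`. -/
def IsSemiquadratic {K : Type*} [Field K] {ℓ : ℕ} (σ : ℕ)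
    (H : (Fin ℓ → K) → (Fin ℓ → K)) : Prop :=
  ∀ i : Fin ℓ, ∃ C : Matrix (Fin ℓ) (Fin ℓ) K, ∀ y : Fin ℓ → K,
    H y i = dotProduct y (C.mulVec (fun j => y j ^ σ))

/-- The map `F = (F₁, F₂, F₃)` on `K ^ 3` with coefficients `a, b, c`; the coordinates of the
argument are `x = w 0`, `y = w 1`, `z = w 2`. -/
def trivariateMap {K : Type*} [Field K] (σ : ℕ) (a b c : K) (w : Fin 3 → K) : Fin 3 → K :=
  let x := w 0
  let y := w 1
  let z := w 2
  ![x ^ (σ + 1) + a * y ^ σ * z + b * x ^ σ * y + c * x ^ σ * z,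
    a * y ^ (σ + 1) + z ^ σ * x + b * z ^ σ * y + c * x ^ σ * y,
    z ^ (σ + 1) + x ^ σ * y]

section CharTwo

variable {K : Type*} [Field K] {σ : ℕ} {a b c : K}

/-! `F(w+u) - F(w)` is `F(u)` plus the polar form `B(u,w)`, additive in `w`. So for `u ≠ 0` it
suffices that `B(u,·)` has kernel `{t u : t^σ = t}`, which has `2^d` elements. On the line through
`u`, `B(u,tu) = (t^σ + t) F(u)`, and `F(u) ≠ 0` because the polynomial has no root
(`eq_zero_of_trivariate_eq_zero`). For `w` off that line with `B(u,w) = 0`, eliminating `w^σ`,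
respectively `w`, yields vectors `α ⊥ u, w` and `β ⊥ u^σ, w^σ`, both linear in `F(u)`. Hence `α^σ =
μ β`, which produces a root of the adjoint polynomial (`eq_zero_of_pow_eq_mul`). A linearized
polynomial is singular when its adjoint is, so the original one has a root as well: a contradiction.
-/

theorem pow_bijective_of_add_pow [Finite K] (hσ0 : σ ≠ 0)
    (hadd : ∀ x y : K, (x + y) ^ σ = x ^ σ + y ^ σ) :
    Function.Bijective (fun x : K => x ^ σ) := by
  refine Finite.injective_iff_bijective.mp fun x y hxy => ?_
  have h : (x - y) ^ σ + y ^ σ = x ^ σ := by rw [← hadd, sub_add_cancel]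
  have hz : (x - y) ^ σ = 0 := by
    have hxy' : x ^ σ = y ^ σ := hxy
    rw [hxy'] at h
    simpa using h
  exact sub_eq_zero.mp ((pow_eq_zero_iff hσ0).mp hz)

/-- A root of the adjoint of the linearized polynomial `a f ^ σ³ + b f ^ σ² + c f ^ σ + f`,
in projective form, yields a projective root of the polynomial itself. -/
theorem exists_root_of_adjoint_root [Finite K] (h2 : (2 : K) = 0) (hσ0 : σ ≠ 0)
    (hadd : ∀ x y : K, (x + y) ^ σ = x ^ σ + y ^ σ) (μ : K)
    (hμ : a * (μ ^ (σ ^ 2) * μ ^ σ * μ) + b ^ σ * (μ ^ (σ ^ 2) * μ ^ σ)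
      + c ^ (σ ^ 2) * μ ^ (σ ^ 2) + 1 = 0) :
    ∃ x : K, a * x ^ (σ ^ 2 + σ + 1) + b * x ^ (σ + 1) + c * x + 1 = 0 := by
  set A := a * (μ ^ (σ ^ 2) * μ ^ σ * μ) with hA
  set B := b * (μ ^ σ * μ) with hB
  set C := c * μ with hC
  have hBs : B ^ σ = b ^ σ * (μ ^ (σ ^ 2) * μ ^ σ) := by
    rw [hB, mul_pow, mul_pow, ← pow_mul, sq]
  have hCs : (C ^ σ) ^ σ = c ^ (σ ^ 2) * μ ^ (σ ^ 2) := by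
    rw [hC, ← pow_mul, ← sq, mul_pow]
  rw [← hBs, ← hCs] at hμ
  have hzero : (0 : K) ^ σ = 0 := zero_pow hσ0
  let L : K →+ K :=
    { toFun := fun f => A * ((f ^ σ) ^ σ) ^ σ + B * (f ^ σ) ^ σ + C * f ^ σ + f
      map_zero' := by simp [hzero]
      map_add' := fun x y => by simp only [hadd]; ring }
  have hL : ∀ f, L f = A * ((f ^ σ) ^ σ) ^ σ + B * (f ^ σ) ^ σ + C * f ^ σ + f := fun _ => rfl
  have hninj : ¬ Function.Injective L := by
    intro hinj
    -- `hμ` says that the adjoint of `L` kills 1. This puts the range of `L` inside that of `h +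
    -- h^σ`, which is not onto since it kills both 0 and 1.
    have hsurj : Function.Surjective (fun h : K => h + h ^ σ) := by
      intro y
      obtain ⟨f, rfl⟩ := Finite.surjective_of_injective hinj y
      -- Modulo the values `h + h^σ`, each `g` equals `g^σ`. The witness records the moves that push
      -- every term of `L f` to `f^(σ³)`, whose total coefficient vanishes by `hμ`.
      refine ⟨C * f ^ σ + (C * f ^ σ) ^ σ + B * (f ^ σ) ^ σ + f + f ^ σ + (f ^ σ) ^ σ, ?_⟩
      simp only [hadd, mul_pow, hL]
      grind
    have h01 := Finite.injective_iff_surjective.mpr hsurj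
      (show (1 : K) + 1 ^ σ = 0 + 0 ^ σ by rw [one_pow, hzero]; linear_combination h2)
    exact one_ne_zero h01
  rw [injective_iff_map_eq_zero] at hninj
  push Not at hninj
  obtain ⟨f, hf, hf0⟩ := hninj
  rw [hL] at hf
  refine ⟨μ * f ^ σ / f, ?_⟩
  have e1 : (μ * f ^ σ / f) ^ (σ + 1) = μ ^ σ * μ * ((f ^ σ) ^ σ / f) := by
    have := pow_ne_zero σ hf0
    rw [pow_succ, div_pow, mul_pow]
    field_simp
  have e2 : (μ * f ^ σ / f) ^ (σ ^ 2 + σ + 1)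
      = μ ^ (σ ^ 2) * μ ^ σ * μ * (((f ^ σ) ^ σ) ^ σ / f) := by
    have h1 := pow_ne_zero σ hf0
    have h3 := pow_ne_zero σ h1
    rw [add_assoc, pow_add, e1, sq, pow_mul, pow_mul, div_pow, div_pow, mul_pow, mul_pow]
    field_simp
  rw [e1, e2]
  have : a * (μ ^ (σ ^ 2) * μ ^ σ * μ * (((f ^ σ) ^ σ) ^ σ / f))
      + b * (μ ^ σ * μ * ((f ^ σ) ^ σ / f)) + c * (μ * f ^ σ / f) + 1
      = (A * ((f ^ σ) ^ σ) ^ σ + B * (f ^ σ) ^ σ + C * f ^ σ + f) / f := by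
    rw [hA, hB, hC]
    field_simp
  rw [this, hf, zero_div]

/-- The trivariate map vanishes only at the origin. -/
theorem eq_zero_of_trivariate_eq_zero (hroot : ∀ x : K,
      a * x ^ (σ ^ 2 + σ + 1) + b * x ^ (σ + 1) + c * x + 1 ≠ 0)
    [Finite K] (h2 : (2 : K) = 0) (hσ0 : σ ≠ 0)
    (hadd : ∀ x y : K, (x + y) ^ σ = x ^ σ + y ^ σ) (ha : a ≠ 0) {x y z : K}
    (h1 : x ^ σ * x + a * y ^ σ * z + b * x ^ σ * y + c * x ^ σ * z = 0)
    (h2' : a * (y ^ σ * y) + z ^ σ * x + b * z ^ σ * y + c * x ^ σ * y = 0)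
    (h3 : z ^ σ * z + x ^ σ * y = 0) : x = 0 ∧ y = 0 ∧ z = 0 := by
  have hzero : (0 : K) ^ σ = 0 := zero_pow hσ0
  by_cases hy : y = 0
  · subst hy
    have hz : z = 0 := by simpa [hσ0] using h3
    subst hz
    have hx : x = 0 := by simpa [hσ0] using h1
    exact ⟨hx, rfl, rfl⟩
  by_cases hz : z = 0
  · subst hz
    have hx : x = 0 := by simpa [hσ0, hy] using h3
    subst hx
    have : y = 0 := by simpa [hσ0, ha] using h2'
    exact ⟨rfl, this, rfl⟩
  exfalso
  have hzσ := pow_ne_zero σ hz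
  have hzσσ := pow_ne_zero σ hzσ
  -- Eliminating `x^σ` from the `σ`-power of `h2'` gives the polynomial at `y / z` with coefficients
  -- `a^σ, b^σ, c^σ`; a `σ`-th root restores `a, b, c`.
  obtain ⟨s, hs⟩ := (pow_bijective_of_add_pow hσ0 hadd).2 (y / z)
  have hs : s ^ σ = y / z := hs
  apply hroot s
  have h4 : x ^ σ = - (z ^ σ * z) / y := by
    field_simp
    linear_combination h3
  have h5 : (a * (y ^ σ * y) + z ^ σ * x + b * z ^ σ * y + c * x ^ σ * y) ^ σ = 0 := by
    rw [h2', hzero]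
  have key : (a * s ^ (σ ^ 2 + σ + 1) + b * s ^ (σ + 1) + c * s + 1) ^ σ = 0 := by
    have e3 : s ^ (σ + 1) = s ^ σ * s := pow_succ _ _
    have e4 : s ^ (σ ^ 2 + σ + 1) = (s ^ σ) ^ σ * s ^ σ * s := by
      rw [pow_succ, pow_add, sq, pow_mul]
    rw [e3, e4]
    simp only [hadd, mul_pow, one_pow, hs, div_pow]
    simp only [hadd, mul_pow, h4, div_pow, neg_pow (z ^ σ * z)] at h5
    have hm : (-1 : K) ^ σ = 1 := by
      rw [show (-1 : K) = 1 by linear_combination -h2, one_pow]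
    rw [hm] at h5
    field_simp at h5 ⊢
    grind
  exact (pow_eq_zero_iff hσ0).mp key

/-- Two vectors orthogonal to the same pair of independent vectors, one of them after taking
`σ`-powers, are proportional after taking `σ`-powers. -/
theorem exists_pow_eq_mul_of_orthogonal [Finite K] (hσ0 : σ ≠ 0)
    (hadd : ∀ x y : K, (x + y) ^ σ = x ^ σ + y ^ σ)
    {x y z p q r α₁ α₂ α₃ β₁ β₂ β₃ : K}
    (hn : ¬ (q * z = r * y ∧ r * x = p * z ∧ p * y = q * x))
    (hβ : ¬ (β₁ = 0 ∧ β₂ = 0 ∧ β₃ = 0))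
    (h1 : α₁ * x + α₂ * y + α₃ * z = 0) (h2' : α₁ * p + α₂ * q + α₃ * r = 0)
    (h3 : β₁ * x ^ σ + β₂ * y ^ σ + β₃ * z ^ σ = 0)
    (h4 : β₁ * p ^ σ + β₂ * q ^ σ + β₃ * r ^ σ = 0) :
    ∃ μ, α₁ ^ σ = μ * β₁ ∧ α₂ ^ σ = μ * β₂ ∧ α₃ ^ σ = μ * β₃ := by
  have hzero : (0 : K) ^ σ = 0 := zero_pow hσ0
  have h1σ : α₁ ^ σ * x ^ σ + α₂ ^ σ * y ^ σ + α₃ ^ σ * z ^ σ = 0 := by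
    rw [← mul_pow, ← mul_pow, ← mul_pow, ← hadd, ← hadd, h1, hzero]
  have h2σ : α₁ ^ σ * p ^ σ + α₂ ^ σ * q ^ σ + α₃ ^ σ * r ^ σ = 0 := by
    rw [← mul_pow, ← mul_pow, ← mul_pow, ← hadd, ← hadd, h2', hzero]
  have hinj := (pow_bijective_of_add_pow hσ0 hadd).1
  have hnσ : ¬ (q ^ σ * z ^ σ = r ^ σ * y ^ σ ∧ r ^ σ * x ^ σ = p ^ σ * z ^ σ ∧
      p ^ σ * y ^ σ = q ^ σ * x ^ σ) := by
    simp only [← mul_pow]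
    exact fun h => hn ⟨hinj h.1, hinj h.2.1, hinj h.2.2⟩
  generalize x ^ σ = X at *
  generalize y ^ σ = Y at *
  generalize z ^ σ = Z at *
  generalize p ^ σ = P at *
  generalize q ^ σ = Q at *
  generalize r ^ σ = R at *
  generalize α₁ ^ σ = A₁ at *
  generalize α₂ ^ σ = A₂ at *
  generalize α₃ ^ σ = A₃ at *
  -- Both `A` and `β` are parallel to the nonzero cross product of `(P, Q, R)` and `(X, Y, Z)`.
  have a1 : A₁ * (R * X - P * Z) = A₂ * (Q * Z - R * Y) := by
    linear_combination R * h1σ - Z * h2σ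
  have a2 : A₂ * (P * Y - Q * X) = A₃ * (R * X - P * Z) := by
    linear_combination P * h1σ - X * h2σ
  have a3 : A₃ * (Q * Z - R * Y) = A₁ * (P * Y - Q * X) := by
    linear_combination Q * h1σ - Y * h2σ
  have b1 : β₁ * (R * X - P * Z) = β₂ * (Q * Z - R * Y) := by
    linear_combination R * h3 - Z * h4
  have b2 : β₂ * (P * Y - Q * X) = β₃ * (R * X - P * Z) := by
    linear_combination P * h3 - X * h4
  have b3 : β₃ * (Q * Z - R * Y) = β₁ * (P * Y - Q * X) := by
    linear_combination Q * h3 - Y * h4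
  rw [← sub_eq_zero, ← sub_eq_zero (a := R * X), ← sub_eq_zero (a := P * Y)] at hnσ
  generalize Q * Z - R * Y = n₁ at *
  generalize R * X - P * Z = n₂ at *
  generalize P * Y - Q * X = n₃ at *
  clear h1σ h2σ h3 h4 h1 h2' hn
  have c1 : A₁ * β₂ = A₂ * β₁ := by
    by_contra hne
    have := sub_ne_zero.mpr hne
    refine hnσ ⟨?_, ?_, ?_⟩ <;> refine (mul_eq_zero.mp ?_).resolve_left this <;> grind
  have c2 : A₁ * β₃ = A₃ * β₁ := by
    by_contra hne
    have := sub_ne_zero.mpr hne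
    refine hnσ ⟨?_, ?_, ?_⟩ <;> refine (mul_eq_zero.mp ?_).resolve_left this <;> grind
  have c3 : A₂ * β₃ = A₃ * β₂ := by
    by_contra hne
    have := sub_ne_zero.mpr hne
    refine hnσ ⟨?_, ?_, ?_⟩ <;> refine (mul_eq_zero.mp ?_).resolve_left this <;> grind
  by_cases hβ₁ : β₁ = 0
  · by_cases hβ₂ : β₂ = 0
    · have hβ₃ : β₃ ≠ 0 := fun h => hβ ⟨hβ₁, hβ₂, h⟩
      exact ⟨A₃ / β₃, by field_simp; grind, by field_simp; grind, by field_simp⟩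
    · exact ⟨A₂ / β₂, by field_simp; grind, by field_simp, by field_simp; grind⟩
  · exact ⟨A₁ / β₁, by field_simp, by field_simp; grind, by field_simp; grind⟩

/-- If the plane orthogonal to `(v₃, v₁ + b v₃, v₂)` is mapped by the `σ`-power map into the plane
orthogonal to `(v₂ + c v₃, a v₃, v₁)`, then the projective polynomial has a root. -/
theorem eq_zero_of_pow_eq_mul (hroot : ∀ x : K,
      a * x ^ (σ ^ 2 + σ + 1) + b * x ^ (σ + 1) + c * x + 1 ≠ 0)
    [Finite K] (h2 : (2 : K) = 0) (hσ0 : σ ≠ 0)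
    (hadd : ∀ x y : K, (x + y) ^ σ = x ^ σ + y ^ σ) {v₁ v₂ v₃ μ : K}
    (h1 : v₃ ^ σ = μ * (v₂ + c * v₃)) (h2' : (v₁ + b * v₃) ^ σ = μ * (a * v₃))
    (h3 : v₂ ^ σ = μ * v₁) : v₁ = 0 ∧ v₂ = 0 ∧ v₃ = 0 := by
  by_cases hv : v₃ = 0
  · subst hv
    have hv1 : v₁ = 0 := by simpa [hσ0] using h2'
    subst hv1
    have hv2 : v₂ = 0 := by simpa [hσ0] using h3
    exact ⟨rfl, hv2, rfl⟩
  exfalso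
  have hvσ := pow_ne_zero σ hv
  -- This rescaling of `μ` amounts to normalising `v₃` to 1; eliminating the two ratios `v₁ / v₃`
  -- and `v₂ / v₃` leaves the adjoint equation for `ν`.
  set ν := μ * v₃ / v₃ ^ σ with hν
  have k1 : ν * (v₂ / v₃ + c) = 1 := by
    rw [hν]
    field_simp
    linear_combination -h1
  have k2 : (v₁ / v₃) ^ σ + b ^ σ = ν * a := by
    rw [hadd, mul_pow] at h2'
    rw [hν, div_pow]
    field_simp
    linear_combination h2'
  have k3 : (v₂ / v₃) ^ σ = ν * (v₁ / v₃) := by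
    rw [hν, div_pow]
    field_simp
    linear_combination h3
  have k4 : (ν ^ σ) ^ σ * (((v₂ / v₃) ^ σ) ^ σ + (c ^ σ) ^ σ) = 1 := by
    rw [← hadd, ← hadd, ← mul_pow, ← mul_pow, k1, one_pow, one_pow]
  have k5 : ((v₂ / v₃) ^ σ) ^ σ = ν ^ σ * (v₁ / v₃) ^ σ := by rw [k3, mul_pow]
  obtain ⟨x, hx⟩ := exists_root_of_adjoint_root (a := a) (b := b) (c := c) h2 hσ0 hadd ν (by
    rw [sq, pow_mul, pow_mul]
    clear_value ν
    clear h1 h2' h3 k1 k3 hv hvσ hroot hadd hσ0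
    generalize (ν ^ σ) ^ σ = N₂ at *
    generalize ν ^ σ = N₁ at *
    generalize ((v₂ / v₃) ^ σ) ^ σ = T at *
    generalize (v₁ / v₃) ^ σ = S at *
    grind)
  exact hroot x hx

/-- If the polar form of the trivariate map vanishes at a nonzero vector `(x, y, z)` and
`(p, q, r)`, then `(p, q, r) = t (x, y, z)` with `t ^ σ = t`. -/
theorem exists_eq_mul_of_polar_eq_zero (hroot : ∀ x : K,
      a * x ^ (σ ^ 2 + σ + 1) + b * x ^ (σ + 1) + c * x + 1 ≠ 0)
    [Finite K] (h2 : (2 : K) = 0) (hσ0 : σ ≠ 0)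
    (hadd : ∀ x y : K, (x + y) ^ σ = x ^ σ + y ^ σ) (ha : a ≠ 0) {x y z p q r : K}
    (hu : ¬ (x = 0 ∧ y = 0 ∧ z = 0))
    (h1 : x ^ σ * p + p ^ σ * x + a * (y ^ σ * r + q ^ σ * z) + b * (x ^ σ * q + p ^ σ * y)
      + c * (x ^ σ * r + p ^ σ * z) = 0)
    (h2' : a * (y ^ σ * q + q ^ σ * y) + (z ^ σ * p + r ^ σ * x) + b * (z ^ σ * q + r ^ σ * y)
      + c * (x ^ σ * q + p ^ σ * y) = 0)
    (h3 : z ^ σ * r + r ^ σ * z + (x ^ σ * q + p ^ σ * y) = 0) :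
    ∃ t : K, t ^ σ = t ∧ p = t * x ∧ q = t * y ∧ r = t * z := by
  obtain ⟨v₁, hv₁⟩ : ∃ v, v = x ^ σ * x + a * y ^ σ * z + b * x ^ σ * y + c * x ^ σ * z := ⟨_, rfl⟩
  obtain ⟨v₂, hv₂⟩ : ∃ v, v = a * (y ^ σ * y) + z ^ σ * x + b * z ^ σ * y + c * x ^ σ * y :=
    ⟨_, rfl⟩
  obtain ⟨v₃, hv₃⟩ : ∃ v, v = z ^ σ * z + x ^ σ * y := ⟨_, rfl⟩
  have hv : ¬ (v₁ = 0 ∧ v₂ = 0 ∧ v₃ = 0) := by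
    rintro ⟨e1, e2, e3⟩
    exact hu (eq_zero_of_trivariate_eq_zero hroot h2 hσ0 hadd ha (hv₁ ▸ e1) (hv₂ ▸ e2) (hv₃ ▸ e3))
  by_cases hn : q * z = r * y ∧ r * x = p * z ∧ p * y = q * x
  · obtain ⟨t, hp, hq, hr⟩ : ∃ t, p = t * x ∧ q = t * y ∧ r = t * z := by
      obtain ⟨n1, n2, n3⟩ := hn
      by_cases hx : x = 0
      · by_cases hy : y = 0
        · have hz : z ≠ 0 := fun hz => hu ⟨hx, hy, hz⟩
          exact ⟨r / z, by field_simp; grind, by field_simp; grind, by field_simp⟩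
        · exact ⟨q / y, by field_simp; grind, by field_simp, by field_simp; grind⟩
      · exact ⟨p / x, by field_simp, by field_simp; grind, by field_simp; grind⟩
    refine ⟨t, ?_, hp, hq, hr⟩
    subst hp hq hr
    simp only [mul_pow] at h1 h2' h3
    by_contra ht
    have ht' : t ^ σ + t ≠ 0 := fun h => ht (by linear_combination h - t * h2)
    refine hv ⟨?_, ?_, ?_⟩
    · refine (mul_eq_zero.mp (?_ : (t ^ σ + t) * v₁ = 0)).resolve_left ht'
      rw [hv₁, ← h1]; ring
    · refine (mul_eq_zero.mp (?_ : (t ^ σ + t) * v₂ = 0)).resolve_left ht'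
      rw [hv₂, ← h2']; ring
    · refine (mul_eq_zero.mp (?_ : (t ^ σ + t) * v₃ = 0)).resolve_left ht'
      rw [hv₃, ← h3]; ring
  exfalso
  -- `o1` and `o3` are identities in characteristic 2. `o2` is `y * h1 + z * h2' + (x + b * y) *
  -- h3`, where `p^σ, q^σ, r^σ` cancel; `o4` uses the multipliers `z^σ`, `x^σ`, `a * y^σ + c * x^σ`,
  -- which cancel `p, q, r`.
  have o1 : v₃ * x + (v₁ + b * v₃) * y + v₂ * z = 0 := by grind
  have o2 : v₃ * p + (v₁ + b * v₃) * q + v₂ * r = 0 := by grind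
  have o3 : (v₂ + c * v₃) * x ^ σ + (a * v₃) * y ^ σ + v₁ * z ^ σ = 0 := by grind
  have o4 : (v₂ + c * v₃) * p ^ σ + (a * v₃) * q ^ σ + v₁ * r ^ σ = 0 := by grind
  clear h1 h2' h3 hv₁ hv₂ hv₃
  obtain ⟨μ, m1, m2, m3⟩ := exists_pow_eq_mul_of_orthogonal hσ0 hadd hn
    (fun h => hv ⟨h.2.2, by simpa [(mul_eq_zero.mp h.2.1).resolve_left ha] using h.1,
      (mul_eq_zero.mp h.2.1).resolve_left ha⟩) o1 o2 o3 o4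
  exact hv (eq_zero_of_pow_eq_mul hroot h2 hσ0 hadd m1 m2 m3)

end CharTwo

/-- The nonzero solutions are the `(2^k - 1)`-torsion of a cyclic group of order `2^m - 1`, and
`gcd(2^k - 1, 2^m - 1) = 2^gcd(k,m) - 1`. -/
theorem ncard_pow_two_pow_eq_self {K : Type*} [Field K] [Finite K] {m k : ℕ}
    (hK : Nat.card K = 2 ^ m) :
    {x : K | x ^ 2 ^ k = x}.ncard = 2 ^ Nat.gcd k m := by
  have hpos : 1 ≤ 2 ^ k := Nat.one_le_two_pow
  have hset : {x : K | x ^ 2 ^ k = x}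
      = insert 0 (Units.val '' ((powMonoidHom (2 ^ k - 1) : Kˣ →* Kˣ).ker : Set Kˣ)) := by
    ext x
    simp only [Set.mem_ofPred_eq, Set.mem_insert_iff, Set.mem_image, SetLike.mem_coe,
      MonoidHom.mem_ker, powMonoidHom_apply]
    constructor
    · intro hx
      by_cases h0 : x = 0
      · exact Or.inl h0
      · refine Or.inr ⟨Units.mk0 x h0, ?_, rfl⟩
        ext
        simp only [Units.val_pow_eq_pow_val, Units.val_mk0, Units.val_one]
        apply mul_right_cancel₀ h0
        rw [← pow_succ, Nat.sub_add_cancel hpos, hx, one_mul]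
    · rintro (rfl | ⟨u, hu, rfl⟩)
      · simp
      · have hu' : (u : K) ^ (2 ^ k - 1) = 1 := by
          rw [← Units.val_pow_eq_pow_val, hu, Units.val_one]
        calc (u : K) ^ 2 ^ k = (u : K) ^ (2 ^ k - 1) * (u : K) := by
              rw [← pow_succ, Nat.sub_add_cancel hpos]
          _ = (u : K) := by rw [hu', one_mul]
  rw [hset, Set.ncard_insert_of_notMem (by simp), Set.ncard_image_of_injective _ Units.val_injective]
  have hker : ((powMonoidHom (2 ^ k - 1) : Kˣ →* Kˣ).ker : Set Kˣ).ncard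
      = 2 ^ Nat.gcd k m - 1 := by
    rw [← Nat.card_coe_set_eq]
    refine (IsCyclic.card_powMonoidHom_ker (G := Kˣ) (2 ^ k - 1)).trans ?_
    rw [Nat.card_units, hK, Nat.pow_sub_one_gcd_pow_sub_one, Nat.gcd_comm]
  rw [hker, Nat.sub_add_cancel Nat.one_le_two_pow]

theorem isSemiquadratic_trivariateMap {K : Type*} [Field K] (σ : ℕ) (a b c : K) :
    IsSemiquadratic σ (trivariateMap σ a b c) := by
  intro i
  fin_cases i
  · refine ⟨!![1, 0, 0; b, 0, 0; c, a, 0], fun y => ?_⟩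
    simp [trivariateMap, dotProduct, Matrix.mulVec, Fin.sum_univ_three, pow_succ]
    ring
  · refine ⟨!![0, 0, 1; c, a, b; 0, 0, 0], fun y => ?_⟩
    simp [trivariateMap, dotProduct, Matrix.mulVec, Fin.sum_univ_three, pow_succ]
    ring
  · refine ⟨!![0, 0, 0; 1, 0, 0; 0, 0, 1], fun y => ?_⟩
    simp [trivariateMap, dotProduct, Matrix.mulVec, Fin.sum_univ_three, pow_succ]
    ring

/-- Two preimages of the same value under a difference map of `trivariateMap` differ by a
multiple of the direction by an element fixed under the `σ`-power map, and conversely. -/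
theorem trivariateMap_diff_eq_iff {K : Type*} [Field K] [Finite K] {σ : ℕ} {a b c : K}
    (hroot : ∀ x : K, a * x ^ (σ ^ 2 + σ + 1) + b * x ^ (σ + 1) + c * x + 1 ≠ 0)
    (h2 : (2 : K) = 0) (hσ0 : σ ≠ 0)
    (hadd : ∀ x y : K, (x + y) ^ σ = x ^ σ + y ^ σ) (ha : a ≠ 0) {u : Fin 3 → K}
    (hu : u ≠ 0) (w₀ w : Fin 3 → K) :
    trivariateMap σ a b c (w + u) - trivariateMap σ a b c w
        = trivariateMap σ a b c (w₀ + u) - trivariateMap σ a b c w₀ ↔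
      ∃ t : K, t ^ σ = t ∧ w = w₀ + t • u := by
  constructor
  · intro h
    obtain ⟨δ, rfl⟩ : ∃ δ, w = w₀ + δ := ⟨w - w₀, by abel⟩
    have e0 := congrFun h 0
    have e1 := congrFun h 1
    have e2 := congrFun h 2
    simp only [trivariateMap, Pi.sub_apply, Pi.add_apply, Matrix.cons_val, pow_succ, hadd]
      at e0 e1 e2
    have hu' : ¬ (u 0 = 0 ∧ u 1 = 0 ∧ u 2 = 0) := by
      rintro ⟨h0, h1, h2⟩
      apply hu
      ext i
      fin_cases i <;> assumption
    obtain ⟨t, ht, t0, t1, t2⟩ := exists_eq_mul_of_polar_eq_zero hroot h2 hσ0 hadd ha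
      (p := δ 0) (q := δ 1) (r := δ 2) hu' (by linear_combination e0)
      (by linear_combination e1) (by linear_combination e2)
    refine ⟨t, ht, ?_⟩
    congr 1
    ext i
    fin_cases i <;> assumption
  · rintro ⟨t, ht, rfl⟩
    ext i
    fin_cases i <;>
    · simp only [trivariateMap, Pi.sub_apply, Pi.add_apply, Pi.smul_apply, smul_eq_mul, hadd,
        mul_pow, ht, pow_succ, Fin.zero_eta, Fin.mk_one, Fin.reduceFinMk, Matrix.cons_val]
      grind

/-- Every nonempty fibre of a difference map in a nonzero direction is a coset of a line over
the fixed field of the `σ`-power map. -/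
theorem ddt_trivariateMap {K : Type*} [Field K] [Finite K] {σ : ℕ} {a b c : K}
    (hroot : ∀ x : K, a * x ^ (σ ^ 2 + σ + 1) + b * x ^ (σ + 1) + c * x + 1 ≠ 0)
    (h2 : (2 : K) = 0) (hσ0 : σ ≠ 0)
    (hadd : ∀ x y : K, (x + y) ^ σ = x ^ σ + y ^ σ) (ha : a ≠ 0) {u : Fin 3 → K}
    (hu : u ≠ 0) (w₀ : Fin 3 → K) :
    ddt (trivariateMap σ a b c) u
        (trivariateMap σ a b c (w₀ + u) - trivariateMap σ a b c w₀)
      = {t : K | t ^ σ = t}.ncard := by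
  have hinj : Function.Injective (fun t : K => w₀ + t • u) :=
    (add_right_injective w₀).comp (smul_left_injective K hu)
  rw [ddt, ← Set.ncard_image_of_injective _ hinj]
  congr 1
  ext w
  rw [Set.mem_ofPred_eq, trivariateMap_diff_eq_iff hroot h2 hσ0 hadd ha hu w₀ w]
  simp only [Set.mem_image, Set.mem_ofPred_eq, eq_comm]

theorem theorem1p3 {K : Type*} [Field K] [Finite K] (m k d σ : ℕ)
    (hK : Nat.card K = 2 ^ m) (hk : 1 ≤ k) (hkm : k < m)
    (hd : d = Nat.gcd k m) (hσ : σ = 2 ^ k)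
    (a b c : K) (ha : a ≠ 0)
    (hroot : ∀ x : K, a * x ^ (σ ^ 2 + σ + 1) + b * x ^ (σ + 1) + c * x + 1 ≠ 0) :
    IsSemiquadratic σ (trivariateMap σ a b c) ∧
      differentialUniformity (trivariateMap σ a b c) = 2 ^ d ∧
      (d = 1 → IsAPN (trivariateMap σ a b c)) := by
  have h2 : (2 : K) = 0 := by
    have h : ((Nat.card K : ℕ) : K) = 0 := by
      have := Fintype.ofFinite K
      rw [Nat.card_eq_fintype_card, Nat.cast_card_eq_zero]
    rw [hK, Nat.cast_pow, Nat.cast_ofNat] at h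
    exact eq_zero_of_pow_eq_zero h
  have : CharP K 2 := CharTwo.of_one_ne_zero_of_two_eq_zero one_ne_zero h2
  have hσ0 : σ ≠ 0 := by rw [hσ]; positivity
  have hadd : ∀ x y : K, (x + y) ^ σ = x ^ σ + y ^ σ := fun x y => by
    rw [hσ, add_pow_char_pow]
  have hcard : {t : K | t ^ σ = t}.ncard = 2 ^ d := by
    rw [hσ, hd, ncard_pow_two_pow_eq_self hK]
  have huni : differentialUniformity (trivariateMap σ a b c) = 2 ^ d := by
    obtain ⟨⟨u, v, hu, huv⟩, hub⟩ := isGreatest_differentialUniformity (trivariateMap σ a b c)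
    apply le_antisymm
    · rw [← huv]
      by_cases hne : ∃ w₀, trivariateMap σ a b c (w₀ + u) - trivariateMap σ a b c w₀ = v
      · obtain ⟨w₀, rfl⟩ := hne
        rw [ddt_trivariateMap hroot h2 hσ0 hadd ha hu w₀, hcard]
      · have : {w | trivariateMap σ a b c (w + u) - trivariateMap σ a b c w = v} = ∅ :=
          Set.eq_empty_of_forall_notMem fun w hw => hne ⟨w, hw⟩
        rw [ddt, this, Set.ncard_empty]
        exact Nat.zero_le _
    -- The fibre through `w₀ = 0` is nonempty, so every nonzero direction attains the bound.
    · exact hub ⟨u, _, hu, (ddt_trivariateMap hroot h2 hσ0 hadd ha hu 0).trans hcard⟩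
  refine ⟨isSemiquadratic_trivariateMap σ a b c, huni, fun h => ?_⟩
  rw [IsAPN, huni, h, pow_one]
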